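/- A straight model $\mathcal M$ of a finite tree $T$ with maximum degree at most $4$ places the vertices of $T$ at distinct points of the rectangular grid $\mathbb Z\times\mathbb Z$ and draws every edge as a horizontal or vertical straight segment, such that the segments of two distinct edges meet only at the image of a common end vertex. A path of $T$ bends at an inner vertex if one of its two segments there is horizontal and the other is vertical. Let $b(\mathcal M)$ be the maximum number of bends of a path between two leaves of $T$ (with $b(\mathcal M)=0$ if $T$ has a single vertex), and let $b(T)$ be the minimum of $b(\mathcal M)$ over all straight models $\mathcal M$ of $T$. Let $T_0$ be the tree with a single vertex. For $k\ge 1$, let $T_k$ be the tree obtained from a path $v_0,v_1,\dots,v_k,v_{k+1}$ by adding, for each $1\le i\le k$, a disjoint copy of the full binary tree of height $\min\{i-1,k-i\}$ (every interior vertex has exactly two children, and all leaves are at level $\min\{i-1,k-i\}$) together with an edge joining its root to $v_i$. **Theorem.** Let $k\ge 0$. If $T$ is a finite tree with maximum degree at most $4$ and $b(T)=k$, then $|V(T)|\ge |V(T_k)|$. Here $|V(T_0)|=1$, and for $k\ge 1$ $$|V(T_k)|=\begin{cases}2^{(k+4)/2}-2 & \text{if } k \text{ is even},\\ 3\cdot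 2^{(k+1)/2}-2 & \text{if } k \text{ is odd},\end{cases}$$ so that these numbers are lower bounds for $|V(T)|$. Moreover, $T_k$ is a tree with maximum degree at most $4$, it has a straight model, and $b(T_k)=k$; hence $T_k$ attains the minimum. -/

import Mathlib

/-- A leaf of a graph: a vertex with exactly one neighbour. -/
def SimpleGraph.IsLeafVertex {V : Type*} (T : SimpleGraph V) (v : V) : Prop :=
  ∃! w, T.Adj v w

/-- A straight model of a graph `T` in the rectangular grid `ℤ × ℤ`: vertices are placed at
distinct grid points, every edge is drawn as a horizontal or vertical straight segment, and the
segments of two different edges meet only in the image of a common end vertex.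

`Set.uIcc (pos u) (pos v)` is the box spanned by `pos u` and `pos v`; since one of the two
coordinates agrees, it is the set of grid points of the straight segment from `pos u` to `pos v`.
Two straight grid segments that meet have a grid point in common. -/
structure StraightModel {V : Type*} (T : SimpleGraph V) where
  pos : V → ℤ × ℤ
  pos_injective : Function.Injective pos
  straight : ∀ ⦃u v : V⦄, T.Adj u v → (pos u).1 = (pos v).1 ∨ (pos u).2 = (pos v).2
  nonintersecting : ∀ ⦃u v x y : V⦄, T.Adj u v → T.Adj x y → s(u, v) ≠ s(x, y) →
    ∀ p : ℤ × ℤ, p ∈ Set.uIcc (pos u) (pos v) → p ∈ Set.uIcc (pos x) (pos y) →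
      ∃ w, (w = u ∨ w = v) ∧ (w = x ∨ w = y) ∧ p = pos w

namespace StraightModel

variable {V : Type*} {T : SimpleGraph V}

/-- A path with consecutive vertices `u, v, w` bends at `v` if its two segments at `v` do not lie
on one vertical grid line and do not lie on one horizontal grid line. -/
def IsBend (M : StraightModel T) (u v w : V) : Prop :=
  ¬ ((M.pos u).1 = (M.pos v).1 ∧ (M.pos v).1 = (M.pos w).1) ∧
  ¬ ((M.pos u).2 = (M.pos v).2 ∧ (M.pos v).2 = (M.pos w).2)

open Classical in
/-- The number of bends along a list of successive vertices. -/
noncomputable def bendsAlong (M : StraightModel T) : List V → ℕ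
  | u :: v :: w :: l => (if M.IsBend u v w then 1 else 0) + M.bendsAlong (v :: w :: l)
  | _ => 0

/-- `b(M)`: the maximum number of bends of a path of `T` between two leaves
(`0` for the one-vertex tree, which has no leaves). -/
noncomputable def bends (M : StraightModel T) : ℕ :=
  sSup {n : ℕ | ∃ (u v : V) (p : T.Walk u v),
    T.IsLeafVertex u ∧ T.IsLeafVertex v ∧ p.IsPath ∧ n = M.bendsAlong p.support}

end StraightModel

/-- `b(T)`: the minimum of `b(M)` over all straight models `M` of `T`. -/
noncomputable def bendNumber {V : Type*} (T : SimpleGraph V) : ℕ :=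
  sInf {n : ℕ | ∃ M : StraightModel T, n = M.bends}

/-- The vertices of the full binary tree of height `d`: a vertex of level `j` is the word of `j`
left/right choices that leads to it from the root, the last choice coming first. -/
abbrev FullBinaryVertex (d : ℕ) : Type := {l : List Bool // l.length ≤ d}

/-- The root of the full binary tree. -/
def fullBinaryRoot (d : ℕ) : FullBinaryVertex d := ⟨[], Nat.zero_le d⟩

/-- The full binary tree of height `d`: the children of the vertex `l` are `false :: l` and
`true :: l`, as long as the level is at most `d`. -/
def fullBinaryTree (d : ℕ) : SimpleGraph (FullBinaryVertex d) :=
  SimpleGraph.fromRel fun x y => ∃ c : Bool, y.1 = c :: x.1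

/-- `d_i = min (i - 1) (k - i)`, used for `1 ≤ i ≤ k` only. -/
def branchHeight (k i : ℕ) : ℕ := min (i - 1) (k - i)

/-- Vertices of the path `v_0, …, v_{k+1}` with a copy of the full binary tree of height `d_i` for
each `1 ≤ i ≤ k`; the element `i : Fin k` of the index set stands for the index `i + 1`. -/
abbrev BranchedPathVertex (k : ℕ) : Type :=
  Fin (k + 2) ⊕ (Σ i : Fin k, FullBinaryVertex (branchHeight k (i.val + 1)))

/-- The edges of the path with binary trees attached, each in one of its two orientations. -/
inductive BranchedPathRel (k : ℕ) : BranchedPathVertex k → BranchedPathVertex k → Prop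
  | path (i j : Fin (k + 2)) (h : j.val = i.val + 1) :
      BranchedPathRel k (Sum.inl i) (Sum.inl j)
  | attach (i : Fin k) (j : Fin (k + 2)) (h : j.val = i.val + 1) :
      BranchedPathRel k (Sum.inl j)
        (Sum.inr ⟨i, fullBinaryRoot (branchHeight k (i.val + 1))⟩)
  | branch (i : Fin k) (x y : FullBinaryVertex (branchHeight k (i.val + 1)))
      (h : (fullBinaryTree (branchHeight k (i.val + 1))).Adj x y) :
      BranchedPathRel k (Sum.inr ⟨i, x⟩) (Sum.inr ⟨i, y⟩)

/-- The path `v_0, …, v_{k+1}` together with disjoint full binary trees of heights `d_i`, the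
`i`-th one joined by an edge from its root to `v_i`. -/
def branchedPath (k : ℕ) : SimpleGraph (BranchedPathVertex k) :=
  SimpleGraph.fromRel (BranchedPathRel k)

/-- The vertices of `T_k`. -/
def ExtremalVertex : ℕ → Type
  | 0 => Unit
  | k + 1 => BranchedPathVertex (k + 1)

/-- The tree `T_k`: a single vertex for `k = 0`, and the path `v_0, …, v_{k+1}` with the full
binary trees attached for `k ≥ 1`. -/
def extremalTree : (k : ℕ) → SimpleGraph (ExtremalVertex k)
  | 0 => (⊥ : SimpleGraph Unit)
  | k + 1 => branchedPath (k + 1)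

instance (d : ℕ) : Finite (FullBinaryVertex d) :=
  (List.finite_length_le Bool d).to_subtype

instance (k : ℕ) : Finite (ExtremalVertex k) := by
  cases k with
  | zero => exact inferInstanceAs (Finite Unit)
  | succ k => exact inferInstanceAs (Finite (BranchedPathVertex (k + 1)))

/-! The proof measures the branch behind an oriented edge `uv` by its Horton–Strahler rank and shows
in effect that `b(T)` is the maximum over edges `uv` of the sum of the two ranks, seen from `u` and
from `v`.

Lower bound: where a branch splits in two, the incoming edge goes straight into at most one of the
parts. So in every model a branch of rank `n` has a path to a leaf with at least `n` bends, and two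
such paths glue along `uv` (`BranchRank.add_le_bends`).

Upper bound: at each vertex the two branches of largest rank are drawn opposite each other, and
likewise the rest. A tree can be drawn with any prescribed cyclic arrangement of edges at each
vertex (`exists_straightModel_of_directions`), and then every bend costs a unit of rank
(`exists_bends_le`).

Counting: rank `n` forces `2^(n+1) - 1` vertices, so ranks `m`, `n` at the two ends of an edge give
`|V| + 2 ≥ 2^(m+1) + 2^(n+1)`. Convexity gives the bound for `m + n ≥ k`. The middle edge of `T_k`
has ranks summing to `k`, and `T_k` is too small for bend number `k + 1`. -/

open SimpleGraph

universe u

/-! ### Horton–Strahler ranks and the size of branches. -/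

/-- `BranchRank T n u v`: seen from `u`, the branch of `T` behind the edge `uv` has
Horton–Strahler rank at least `n`. -/
inductive BranchRank {V : Type*} (T : SimpleGraph V) : ℕ → V → V → Prop
  | zero {u v : V} (h : T.Adj u v) : BranchRank T 0 u v
  | step {n : ℕ} {u v w : V} (h : T.Adj u v) (hw : w ≠ u) (h' : BranchRank T n v w) :
      BranchRank T n u v
  | branch {n : ℕ} {u v w w' : V} (h : T.Adj u v) (hw : w ≠ u) (hw' : w' ≠ u) (hne : w ≠ w')
      (h₁ : BranchRank T n v w) (h₂ : BranchRank T n v w') : BranchRank T (n + 1) u v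

namespace BranchRank

variable {V : Type*} {T : SimpleGraph V}

theorem adj {n : ℕ} {u v : V} (h : BranchRank T n u v) : T.Adj u v := by
  cases h <;> assumption

end BranchRank

/-- Prefixing `a` would give two paths from `a` to `x` with different second vertices. -/
theorem SimpleGraph.IsAcyclic.branch_disjoint {V : Type*} {T : SimpleGraph V} (hT : T.IsAcyclic)
    {a b c x : V} (hab : T.Adj a b) (hac : T.Adj a c) (hbc : b ≠ c)
    (p : T.Walk b x) (hp : p.IsPath) (hpa : a ∉ p.support)
    (q : T.Walk c x) (hq : q.IsPath) (hqa : a ∉ q.support) : False := by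
  have h := (hT.subsingleton_path _ _).elim ⟨Walk.cons hab p, hp.cons hpa⟩
    ⟨Walk.cons hac q, hq.cons hqa⟩
  simp only [Subtype.mk.injEq, Walk.cons.injEq] at h
  exact hbc h.1

theorem SimpleGraph.IsAcyclic.notMem_support_of_adj {V : Type*} {T : SimpleGraph V}
    (hT : T.IsAcyclic) {u v w x : V} (huv : T.Adj u v) (hvw : T.Adj v w) (hwu : w ≠ u)
    (p : T.Walk w x) (hp : p.IsPath) (hpv : v ∉ p.support) : u ∉ p.support := by
  classical
  intro hu
  exact hT.branch_disjoint hvw huv.symm hwu (p.takeUntil u hu) (hp.takeUntil hu)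
    (fun h => hpv (p.support_takeUntil_subset_support hu h)) Walk.nil Walk.IsPath.nil
    (by simpa using huv.ne')

theorem SimpleGraph.IsAcyclic.opposite_branch_disjoint {V : Type*} {T : SimpleGraph V}
    (hT : T.IsAcyclic) {u v x : V} (huv : T.Adj u v)
    (p : T.Walk v x) (hp : p.IsPath) (hpu : u ∉ p.support)
    (q : T.Walk u x) (hq : q.IsPath) (hqv : v ∉ q.support) : False := by
  have h := (hT.subsingleton_path _ _).elim ⟨Walk.cons huv p, hp.cons hpu⟩ ⟨q, hq⟩
  simp only [Subtype.mk.injEq] at h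
  apply hqv
  rw [← h]
  simp

/-- The vertices behind `uv` are those reached from `v` by a path avoiding `u`. At a split, the two
disjoint sets and `v` itself combine as in a full binary tree. -/
theorem BranchRank.exists_finset {V : Type*} {T : SimpleGraph V} (hT : T.IsAcyclic)
    {n : ℕ} {u v : V} (h : BranchRank T n u v) :
    ∃ s : Finset V, 2 ^ (n + 1) ≤ s.card + 1 ∧
      ∀ x ∈ s, ∃ p : T.Walk v x, p.IsPath ∧ u ∉ p.support := by
  classical
  induction h with
  | @zero u v h =>
    refine ⟨{v}, by simp, ?_⟩
    intro x hx
    obtain rfl := Finset.mem_singleton.1 hx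
    exact ⟨Walk.nil, Walk.IsPath.nil, by simpa using h.ne⟩
  | @step n u v w h hw h' ih =>
    obtain ⟨s, hs, hp⟩ := ih
    refine ⟨s, hs, fun x hx => ?_⟩
    obtain ⟨p, hp, hv⟩ := hp x hx
    refine ⟨Walk.cons h'.adj p, hp.cons hv, ?_⟩
    simp only [Walk.support_cons, List.mem_cons, not_or]
    exact ⟨h.ne, hT.notMem_support_of_adj h h'.adj hw p hp hv⟩
  | @branch n u v w w' h hw hw' hne h₁ h₂ ih₁ ih₂ =>
    obtain ⟨s, hs, hps⟩ := ih₁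
    obtain ⟨t, ht, hpt⟩ := ih₂
    have hdisj : Disjoint s t := by
      rw [Finset.disjoint_left]
      intro x hx hx'
      obtain ⟨p, hp, hpv⟩ := hps x hx
      obtain ⟨q, hq, hqv⟩ := hpt x hx'
      exact hT.branch_disjoint h₁.adj h₂.adj hne p hp hpv q hq hqv
    have hv : v ∉ s ∪ t := by
      intro hv
      rcases Finset.mem_union.1 hv with hv | hv
      · obtain ⟨p, _, hpv⟩ := hps v hv
        exact hpv p.end_mem_support
      · obtain ⟨p, _, hpv⟩ := hpt v hv
        exact hpv p.end_mem_support
    refine ⟨insert v (s ∪ t), ?_, ?_⟩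
    · rw [Finset.card_insert_of_notMem hv, Finset.card_union_of_disjoint hdisj, pow_succ]
      omega
    · intro x hx
      rcases Finset.mem_insert.1 hx with rfl | hx
      · exact ⟨Walk.nil, Walk.IsPath.nil, by simpa using h.ne⟩
      · rcases Finset.mem_union.1 hx with hx | hx
        · obtain ⟨p, hp, hv⟩ := hps x hx
          refine ⟨Walk.cons h₁.adj p, hp.cons hv, ?_⟩
          simp only [Walk.support_cons, List.mem_cons, not_or]
          exact ⟨h.ne, hT.notMem_support_of_adj h h₁.adj hw p hp hv⟩
        · obtain ⟨p, hp, hv⟩ := hpt x hx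
          refine ⟨Walk.cons h₂.adj p, hp.cons hv, ?_⟩
          simp only [Walk.support_cons, List.mem_cons, not_or]
          exact ⟨h.ne, hT.notMem_support_of_adj h h₂.adj hw' p hp hv⟩

theorem BranchRank.two_pow_add_two_pow_le_card {V : Type*} [Finite V] {T : SimpleGraph V}
    (hT : T.IsAcyclic) {m n : ℕ} {u v : V} (h : BranchRank T m u v) (h' : BranchRank T n v u) :
    2 ^ (m + 1) + 2 ^ (n + 1) ≤ Nat.card V + 2 := by
  classical
  cases nonempty_fintype V
  obtain ⟨s, hs, hps⟩ := h.exists_finset hT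
  obtain ⟨t, ht, hpt⟩ := h'.exists_finset hT
  have hdisj : Disjoint s t := by
    rw [Finset.disjoint_left]
    intro x hx hx'
    obtain ⟨p, hp, hpv⟩ := hps x hx
    obtain ⟨q, hq, hqv⟩ := hpt x hx'
    exact hT.opposite_branch_disjoint h.adj p hp hpv q hq hqv
  have := Finset.card_le_univ (s ∪ t)
  rw [Finset.card_union_of_disjoint hdisj] at this
  rw [Nat.card_eq_fintype_card]
  omega

/-! ### Bends forced in every straight model. -/

/-- A path that has not reached a leaf can be prolonged past its end, and acyclicity keeps the new
vertex off it. The number of vertices bounds the length. -/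
theorem SimpleGraph.IsAcyclic.exists_leaf_of_adj {V : Type*} [Finite V] {T : SimpleGraph V}
    (hT : T.IsAcyclic) {u v : V} (huv : T.Adj u v) :
    ∃ (z : V) (p : T.Walk v z), p.IsPath ∧ u ∉ p.support ∧ T.IsLeafVertex z := by
  classical
  cases nonempty_fintype V
  suffices H : ∀ (n : ℕ) (z : V) (p : T.Walk v z), p.IsPath → u ∉ p.support →
      Fintype.card V ≤ p.length + n →
      ∃ (z : V) (p : T.Walk v z), p.IsPath ∧ u ∉ p.support ∧ T.IsLeafVertex z from
    H _ v Walk.nil Walk.IsPath.nil (by simpa using huv.ne) (Nat.le_add_left _ _)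
  intro n
  induction n with
  | zero =>
    intro z p hp _ hcard
    have := hp.length_lt
    omega
  | succ n ih =>
    intro z p hp hu hcard
    have hq : (Walk.cons huv p).IsPath := hp.cons hu
    by_cases hz : T.IsLeafVertex z
    · exact ⟨z, p, hp, hu, hz⟩
    · have hpen : T.Adj z (Walk.cons huv p).penultimate :=
        ((Walk.cons huv p).adj_penultimate (by simp)).symm
      obtain ⟨w, hw, hne⟩ : ∃ w, T.Adj z w ∧ w ≠ (Walk.cons huv p).penultimate := by
        by_contra! hcon
        exact hz ⟨_, hpen, hcon⟩
      have hmem : w ∉ (Walk.cons huv p).support := by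
        intro hmem
        exact hne (hT.eq_penultimate_of_adj_end hq hw hmem)
      rw [Walk.support_cons, List.mem_cons, not_or] at hmem
      refine ih w (p.concat hw) (hp.concat hmem.2 hw) ?_ ?_
      · rw [Walk.support_concat]
        simp only [List.mem_append, List.mem_singleton, not_or]
        exact ⟨hu, fun h => hmem.1 h.symm⟩
      · rw [Walk.length_concat]
        omega

theorem Int.mem_uIcc_prod {a b p : ℤ × ℤ} : p ∈ Set.uIcc a b ↔
    (min a.1 b.1 ≤ p.1 ∧ p.1 ≤ max a.1 b.1) ∧ (min a.2 b.2 ≤ p.2 ∧ p.2 ≤ max a.2 b.2) := by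
  simp only [Set.uIcc, Set.mem_Icc, Prod.le_def, Prod.fst_inf, Prod.snd_inf, Prod.fst_sup,
    Prod.snd_sup]
  tauto

namespace StraightModel

variable {V : Type*} {T : SimpleGraph V} (M : StraightModel T)

theorem isBend_comm {u v w : V} : M.IsBend u v w ↔ M.IsBend w v u := by
  unfold IsBend
  constructor <;> rintro ⟨h₁, h₂⟩ <;>
    exact ⟨fun h => h₁ ⟨h.2.symm, h.1.symm⟩, fun h => h₂ ⟨h.2.symm, h.1.symm⟩⟩

theorem eq_pos_of_mem_uIcc {v a b : V} (ha : T.Adj v a) (hb : T.Adj v b) (hab : a ≠ b)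
    {p : ℤ × ℤ} (hpa : p ∈ Set.uIcc (M.pos v) (M.pos a)) (hpb : p ∈ Set.uIcc (M.pos v) (M.pos b)) :
    p = M.pos v := by
  obtain ⟨w, hw, hw', rfl⟩ := M.nonintersecting ha hb (by simp [hab, hb.ne]) p hpa hpb
  rcases hw with rfl | rfl
  · rfl
  · rcases hw' with rfl | rfl
    · rfl
    · exact absurd rfl hab

theorem opposite_of_same_fst {v a b : V} (ha : T.Adj v a) (hb : T.Adj v b) (hab : a ≠ b)
    (h1 : (M.pos a).1 = (M.pos v).1) (h2 : (M.pos b).1 = (M.pos v).1) :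
    ((M.pos a).2 < (M.pos v).2 ∧ (M.pos v).2 < (M.pos b).2) ∨
      ((M.pos b).2 < (M.pos v).2 ∧ (M.pos v).2 < (M.pos a).2) := by
  have hna : M.pos a ≠ M.pos v := fun h => ha.ne (M.pos_injective h).symm
  have hnb : M.pos b ≠ M.pos v := fun h => hb.ne (M.pos_injective h).symm
  have key := fun q => M.eq_pos_of_mem_uIcc ha hb hab (p := q)
  -- If both edges left `v` on the same side, the grid point next to `v` on that side would lie on
  -- both segments.
  have k1 := key ((M.pos v).1, (M.pos v).2 + 1)
  have k2 := key ((M.pos v).1, (M.pos v).2 - 1)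
  simp only [Int.mem_uIcc_prod, Prod.ext_iff, ne_eq] at hna hnb k1 k2
  omega

theorem opposite_of_same_snd {v a b : V} (ha : T.Adj v a) (hb : T.Adj v b) (hab : a ≠ b)
    (h1 : (M.pos a).2 = (M.pos v).2) (h2 : (M.pos b).2 = (M.pos v).2) :
    ((M.pos a).1 < (M.pos v).1 ∧ (M.pos v).1 < (M.pos b).1) ∨
      ((M.pos b).1 < (M.pos v).1 ∧ (M.pos v).1 < (M.pos a).1) := by
  have hna : M.pos a ≠ M.pos v := fun h => ha.ne (M.pos_injective h).symm
  have hnb : M.pos b ≠ M.pos v := fun h => hb.ne (M.pos_injective h).symm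
  have key := fun q => M.eq_pos_of_mem_uIcc ha hb hab (p := q)
  have k1 := key ((M.pos v).1 + 1, (M.pos v).2)
  have k2 := key ((M.pos v).1 - 1, (M.pos v).2)
  simp only [Int.mem_uIcc_prod, Prod.ext_iff, ne_eq] at hna hnb k1 k2
  omega

/-- Otherwise three edges leave `v` along one grid line, pairwise on opposite sides. -/
theorem isBend_or_isBend {u v w w' : V} (hu : T.Adj v u) (hw : T.Adj v w) (hw' : T.Adj v w')
    (huw : w ≠ u) (huw' : w' ≠ u) (hne : w ≠ w') : M.IsBend u v w ∨ M.IsBend u v w' := by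
  by_contra! hcon
  have hnu : ¬ ((M.pos u).1 = (M.pos v).1 ∧ (M.pos u).2 = (M.pos v).2) :=
    fun h => hu.ne (M.pos_injective (Prod.ext h.1 h.2)).symm
  unfold IsBend at hcon
  by_cases hx : (M.pos u).1 = (M.pos v).1
  · have h1 := M.opposite_of_same_fst hu hw huw.symm hx (by omega)
    have h2 := M.opposite_of_same_fst hu hw' huw'.symm hx (by omega)
    have h3 := M.opposite_of_same_fst hw hw' hne (by omega) (by omega)
    omega
  · have h1 := M.opposite_of_same_snd hu hw huw.symm (by omega) (by omega)
    have h2 := M.opposite_of_same_snd hu hw' huw'.symm (by omega) (by omega)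
    have h3 := M.opposite_of_same_snd hw hw' hne (by omega) (by omega)
    omega

/-- Bends are read off triples, so cutting a list without loss needs two shared vertices. -/
theorem bendsAlong_append (a b : V) (l' : List V) : ∀ l : List V,
    M.bendsAlong (l ++ a :: b :: l') = M.bendsAlong (l ++ [a, b]) + M.bendsAlong (a :: b :: l')
  | [] => by simp [bendsAlong]
  | [x] => by simp [bendsAlong]
  | [x, y] => by
    have := bendsAlong_append a b l' [y]
    simp only [List.cons_append, List.nil_append] at this ⊢
    rw [bendsAlong, this, bendsAlong.eq_1 M x y, add_assoc]
  | x :: y :: z :: l => by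
    have := bendsAlong_append a b l' (y :: z :: l)
    simp only [List.cons_append] at this ⊢
    rw [bendsAlong, bendsAlong, this, add_assoc]

theorem bendsAlong_reverse : ∀ l : List V, M.bendsAlong l.reverse = M.bendsAlong l
  | [] => rfl
  | [x] => rfl
  | [x, y] => by simp [bendsAlong]
  | x :: y :: z :: l => by
    have := bendsAlong_reverse (y :: z :: l)
    rw [bendsAlong, ← this]
    simp only [List.reverse_cons, List.append_assoc, List.cons_append, List.nil_append]
    rw [bendsAlong_append, add_comm]
    congr 1
    simp only [bendsAlong, add_zero]
    rw [M.isBend_comm]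

theorem bendsAlong_le_length : ∀ l : List V, M.bendsAlong l ≤ l.length
  | [] => by simp [bendsAlong]
  | [x] => by simp [bendsAlong]
  | [x, y] => by simp [bendsAlong]
  | x :: y :: z :: l => by
    have := bendsAlong_le_length (y :: z :: l)
    rw [bendsAlong, List.length_cons]
    split_ifs <;> omega

theorem bendsAlong_le_bends [Finite V] {u v : V} (hu : T.IsLeafVertex u) (hv : T.IsLeafVertex v)
    (p : T.Walk u v) (hp : p.IsPath) : M.bendsAlong p.support ≤ M.bends := by
  cases nonempty_fintype V
  refine le_csSup ⟨Fintype.card V, ?_⟩ ⟨u, v, p, hu, hv, hp, rfl⟩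
  rintro n ⟨u, v, p, -, -, hp, rfl⟩
  have h1 := M.bendsAlong_le_length p.support
  have h2 := hp.length_lt
  rw [Walk.length_support] at h1
  omega

end StraightModel

/-- The list starts at `u` so that the turn at `v` is counted. At a split, the induction follows a
part into which the path bends. -/
theorem BranchRank.exists_isPath_le_bendsAlong {V : Type*} [Finite V] {T : SimpleGraph V}
    (hT : T.IsAcyclic) (M : StraightModel T) {n : ℕ} {u v : V} (h : BranchRank T n u v) :
    ∃ (z : V) (p : T.Walk v z), p.IsPath ∧ u ∉ p.support ∧ T.IsLeafVertex z ∧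
      n ≤ M.bendsAlong (u :: p.support) := by
  have extend : ∀ {u v w z : V} (p : T.Walk w z), T.Adj u v → w ≠ u → ∀ hvw : T.Adj v w,
      p.IsPath → v ∉ p.support →
      (Walk.cons hvw p).IsPath ∧ u ∉ (Walk.cons hvw p).support ∧
        ∃ l, (Walk.cons hvw p).support = v :: w :: l ∧ v :: p.support = v :: w :: l := by
    intro u v w z p huv hwu hvw hp hv
    refine ⟨hp.cons hv, ?_, p.support.tail, ?_, ?_⟩
    · simp only [Walk.support_cons, List.mem_cons, not_or]
      exact ⟨huv.ne, hT.notMem_support_of_adj huv hvw hwu p hp hv⟩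
    · rw [Walk.support_cons, Walk.cons_tail_support]
    · rw [Walk.cons_tail_support]
  induction h with
  | zero h =>
    obtain ⟨z, p, hp, hu, hz⟩ := hT.exists_leaf_of_adj h
    exact ⟨z, p, hp, hu, hz, Nat.zero_le _⟩
  | @step n u v w h hw h' ih =>
    obtain ⟨z, p, hp, hv, hz, hn⟩ := ih
    obtain ⟨h1, h2, l, h3, h4⟩ := extend p h hw h'.adj hp hv
    refine ⟨z, _, h1, h2, hz, ?_⟩
    rw [h4] at hn
    rw [h3, StraightModel.bendsAlong]
    omega
  | @branch n u v w w' h hw hw' hne h₁ h₂ ih₁ ih₂ =>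
    rcases M.isBend_or_isBend h.symm h₁.adj h₂.adj hw hw' hne with hb | hb
    · obtain ⟨z, p, hp, hv, hz, hn⟩ := ih₁
      obtain ⟨h1, h2, l, h3, h4⟩ := extend p h hw h₁.adj hp hv
      refine ⟨z, _, h1, h2, hz, ?_⟩
      rw [h4] at hn
      rw [h3, StraightModel.bendsAlong, if_pos hb]
      omega
    · obtain ⟨z, p, hp, hv, hz, hn⟩ := ih₂
      obtain ⟨h1, h2, l, h3, h4⟩ := extend p h hw' h₂.adj hp hv
      refine ⟨z, _, h1, h2, hz, ?_⟩
      rw [h4] at hn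
      rw [h3, StraightModel.bendsAlong, if_pos hb]
      omega

theorem BranchRank.add_le_bends {V : Type*} [Finite V] {T : SimpleGraph V} (hT : T.IsAcyclic)
    (M : StraightModel T) {m n : ℕ} {u v : V} (h : BranchRank T m u v) (h' : BranchRank T n v u) :
    m + n ≤ M.bends := by
  obtain ⟨y, p, hp, hu, hy, hm⟩ := h.exists_isPath_le_bendsAlong hT M
  obtain ⟨z, q, hq, hv, hz, hn⟩ := h'.exists_isPath_le_bendsAlong hT M
  have hpath : (q.reverse.append (Walk.cons h.adj p)).IsPath := by
    rw [Walk.isPath_def, Walk.support_append, Walk.support_reverse, Walk.support_cons,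
      List.tail_cons, List.nodup_append']
    refine ⟨List.nodup_reverse.2 hq.support_nodup, hp.support_nodup, ?_⟩
    intro x hx hx'
    classical
    rw [List.mem_reverse] at hx
    refine hT.opposite_branch_disjoint h.adj (p.takeUntil x hx') (hp.takeUntil hx')
      (fun hmem => hu (p.support_takeUntil_subset_support hx' hmem))
      (q.takeUntil x hx) (hq.takeUntil hx)
      (fun hmem => hv (q.support_takeUntil_subset_support hx hmem))
  refine le_trans ?_ (M.bendsAlong_le_bends hz hy _ hpath)
  rw [Walk.support_append, Walk.support_reverse, Walk.support_cons, List.tail_cons]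
  rw [← Walk.cons_tail_support p] at hm ⊢
  rw [← Walk.cons_tail_support q] at hn ⊢
  -- The two halves overlap in the edge `uv`: the turn at `u` is counted in the second path, the
  -- turn at `v` in the first.
  rw [List.reverse_cons, List.append_assoc, List.singleton_append,
    StraightModel.bendsAlong_append]
  rw [← M.bendsAlong_reverse] at hn
  simp only [List.reverse_cons, List.append_assoc, List.cons_append, List.nil_append] at hn
  omega

/-! ### Drawing a tree with prescribed directions. -/

/-- The four unit steps of the grid, in cyclic order. -/
def gridStep (d : ZMod 4) : ℤ × ℤ :=
  if d = 0 then (1, 0) else if d = 1 then (0, 1) else if d = 2 then (-1, 0) else (0, -1)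

theorem gridStep_add_two (d : ZMod 4) : gridStep (d + 2) = -gridStep d := by
  revert d; decide

theorem gridStep_cases (d : ZMod 4) : (d = 0 ∧ gridStep d = (1, 0)) ∨
    (d = 1 ∧ gridStep d = (0, 1)) ∨ (d = 2 ∧ gridStep d = (-1, 0)) ∨
    (d = 3 ∧ gridStep d = (0, -1)) := by
  revert d; decide

theorem eq_of_add_gridStep_mem_uIcc {a : ℤ × ℤ} {d e : ZMod 4} {l : ℤ} (hl : 0 < l)
    (h : a + gridStep d ∈ Set.uIcc a (a + l • gridStep e)) : d = e := by
  rw [Int.mem_uIcc_prod] at h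
  rcases gridStep_cases d with ⟨rfl, hd⟩ | ⟨rfl, hd⟩ | ⟨rfl, hd⟩ | ⟨rfl, hd⟩ <;>
  rcases gridStep_cases e with ⟨rfl, he⟩ | ⟨rfl, he⟩ | ⟨rfl, he⟩ | ⟨rfl, he⟩ <;>
  first
  | rfl
  | (rw [hd, he] at h
     simp only [Prod.fst_add, Prod.snd_add, Prod.smul_mk, smul_eq_mul] at h
     omega)

theorem eq_or_eq_of_mem_uIcc_add_gridStep {a p : ℤ × ℤ} {d : ZMod 4}
    (h : p ∈ Set.uIcc a (a + gridStep d)) : p = a ∨ p = a + gridStep d := by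
  rw [Int.mem_uIcc_prod] at h
  rcases gridStep_cases d with ⟨rfl, hd⟩ | ⟨rfl, hd⟩ | ⟨rfl, hd⟩ | ⟨rfl, hd⟩ <;>
  · rw [hd] at h ⊢
    simp only [Prod.fst_add, Prod.snd_add, Prod.ext_iff] at h ⊢
    omega

theorem mem_uIcc_of_two_nsmul_mem {a b p : ℤ × ℤ}
    (h : (2 : ℕ) • p ∈ Set.uIcc ((2 : ℕ) • a) ((2 : ℕ) • b)) : p ∈ Set.uIcc a b := by
  rw [Int.mem_uIcc_prod] at h ⊢
  simp only [two_nsmul, Prod.fst_add, Prod.snd_add] at h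
  omega

theorem two_nsmul_add_gridStep_ne {a b : ℤ × ℤ} {d : ZMod 4} :
    (2 : ℕ) • a + gridStep d ≠ (2 : ℕ) • b := by
  intro h
  rcases gridStep_cases d with ⟨rfl, hd⟩ | ⟨rfl, hd⟩ | ⟨rfl, hd⟩ | ⟨rfl, hd⟩ <;>
  · rw [hd] at h
    simp only [Prod.ext_iff, two_nsmul, Prod.fst_add, Prod.snd_add] at h
    omega

theorem mem_uIcc_of_two_nsmul_add_gridStep_mem {a b p : ℤ × ℤ} {d : ZMod 4}
    (h : (2 : ℕ) • p + gridStep d ∈ Set.uIcc ((2 : ℕ) • a) ((2 : ℕ) • b)) :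
    p ∈ Set.uIcc a b ∧ p + gridStep d ∈ Set.uIcc a b := by
  rw [Int.mem_uIcc_prod] at h ⊢
  rw [Int.mem_uIcc_prod]
  rcases gridStep_cases d with ⟨rfl, hd⟩ | ⟨rfl, hd⟩ | ⟨rfl, hd⟩ | ⟨rfl, hd⟩ <;>
  · rw [hd] at h ⊢
    simp only [two_nsmul, Prod.fst_add, Prod.snd_add] at h ⊢
    omega

/-- A drawing of the part of `T` spanned by `S` in which, up to a rotation `s v` at every vertex
`v`, the edge from `v` to `w` leaves `v` in the direction `c v w`. -/
structure DirectedDrawing {V : Type u} (T : SimpleGraph V) (c : V → V → ZMod 4) (S : Set V)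
    (s : V → ZMod 4) (pos : V → ℤ × ℤ) : Prop where
  injOn : ∀ ⦃v w⦄, v ∈ S → w ∈ S → pos v = pos w → v = w
  edge : ∀ ⦃v w⦄, v ∈ S → w ∈ S → T.Adj v w →
    ∃ l : ℤ, 0 < l ∧ pos w = pos v + l • gridStep (c v w + s v)
  -- Kept as a separate field because disjointness of edges says nothing about a vertex with no edge
  -- in `S`.
  mem_segment : ∀ ⦃v w x⦄, v ∈ S → w ∈ S → x ∈ S → T.Adj v w →
    pos x ∈ Set.uIcc (pos v) (pos w) → x = v ∨ x = w
  nonintersecting : ∀ ⦃u v x y⦄, u ∈ S → v ∈ S → x ∈ S → y ∈ S → T.Adj u v → T.Adj x y →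
    s(u, v) ≠ s(x, y) → ∀ p : ℤ × ℤ, p ∈ Set.uIcc (pos u) (pos v) →
      p ∈ Set.uIcc (pos x) (pos y) → ∃ w, (w = u ∨ w = v) ∧ (w = x ∨ w = y) ∧ p = pos w

theorem DirectedDrawing.nonintersecting_two_nsmul {V : Type u} {T : SimpleGraph V}
    {c : V → V → ZMod 4} {S : Set V} {s : V → ZMod 4} {pos : V → ℤ × ℤ}
    (D : DirectedDrawing T c S s pos) {u v x y : V} (hu : u ∈ S) (hv : v ∈ S) (hx : x ∈ S)
    (hy : y ∈ S) (huv : T.Adj u v) (hxy : T.Adj x y) (hne : s(u, v) ≠ s(x, y)) {p : ℤ × ℤ}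
    (hp : p ∈ Set.uIcc ((2 : ℕ) • pos u) ((2 : ℕ) • pos v))
    (hp' : p ∈ Set.uIcc ((2 : ℕ) • pos x) ((2 : ℕ) • pos y)) :
    ∃ w, (w = u ∨ w = v) ∧ (w = x ∨ w = y) ∧ p = (2 : ℕ) • pos w := by
  -- Halving `p` with rounding down and up gives two common points of the original segments. If they
  -- are the same vertex, `p` is its double; if not, the two edges share both ends.
  have floor_mem : ∀ a b : ℤ × ℤ, p ∈ Set.uIcc ((2 : ℕ) • a) ((2 : ℕ) • b) →
      (p.1 / 2, p.2 / 2) ∈ Set.uIcc a b ∧ ((p.1 + 1) / 2, (p.2 + 1) / 2) ∈ Set.uIcc a b := by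
    intro a b h
    rw [Int.mem_uIcc_prod] at h ⊢
    rw [Int.mem_uIcc_prod]
    simp only [two_nsmul, Prod.fst_add, Prod.snd_add] at h ⊢
    omega
  obtain ⟨w, hw, hw', hq⟩ := D.nonintersecting hu hv hx hy huv hxy hne _
    (floor_mem _ _ hp).1 (floor_mem _ _ hp').1
  obtain ⟨z, hz, hz', hr⟩ := D.nonintersecting hu hv hx hy huv hxy hne _
    (floor_mem _ _ hp).2 (floor_mem _ _ hp').2
  by_cases hwz : w = z
  · subst hwz
    refine ⟨w, hw, hw', ?_⟩
    simp only [Prod.ext_iff, two_nsmul, Prod.fst_add, Prod.snd_add]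
      at hq hr ⊢
    omega
  · exfalso
    apply hne
    rw [(Sym2.mem_and_mem_iff hwz).1 ⟨Sym2.mem_iff.2 hw, Sym2.mem_iff.2 hz⟩,
      (Sym2.mem_and_mem_iff hwz).1 ⟨Sym2.mem_iff.2 hw', Sym2.mem_iff.2 hz'⟩]

/-- Doubling the drawing makes room to put the leaf one unit from its neighbour `u`. That point
could be covered only by an edge leaving `u` in the same direction, which `hc` excludes. -/
theorem DirectedDrawing.extend_leaf {V : Type u} {T : SimpleGraph V} {c : V → V → ZMod 4}
    (hc : ∀ ⦃v w w'⦄, T.Adj v w → T.Adj v w' → c v w = c v w' → w = w')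
    {x u : V} (hxu : T.Adj x u) (huniq : ∀ y, T.Adj x y → y = u)
    {s : V → ZMod 4} {pos : V → ℤ × ℤ} (D : DirectedDrawing T c {x}ᶜ s pos) :
    ∃ s' pos', DirectedDrawing T c Set.univ s' pos' := by
  classical
  set d : ZMod 4 := c u x + s u with hd
  have hu : u ∈ ({x}ᶜ : Set V) := hxu.ne'
  have hux : u ≠ x := hxu.ne'
  have huniq' : ∀ y, T.Adj y x → y = u := fun y hy => huniq y hy.symm
  have new_notMem : ∀ a b, a ≠ x → b ≠ x → T.Adj a b →
      (2 : ℕ) • pos u + gridStep d ∉ Set.uIcc ((2 : ℕ) • pos a) ((2 : ℕ) • pos b) := by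
    intro a b ha hb hab h
    have key : ∀ a b, a ≠ x → b ≠ x → T.Adj a b → u = a →
        pos u + gridStep d ∈ Set.uIcc (pos a) (pos b) → False := by
      rintro a b ha hb hab rfl h
      obtain ⟨l, hl, hlb⟩ := D.edge ha hb hab
      rw [hlb] at h
      have := eq_of_add_gridStep_mem_uIcc hl h
      exact hb (hc hxu.symm hab (by simpa [hd] using this)).symm
    obtain ⟨h1, h2⟩ := mem_uIcc_of_two_nsmul_add_gridStep_mem h
    rcases D.mem_segment ha hb hu hab h1 with h3 | h3
    · exact key a b ha hb hab h3 h2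
    · exact key b a hb ha hab.symm h3 (by rwa [Set.uIcc_comm])
  have new_old : ∀ a b, a ≠ x → b ≠ x → T.Adj a b → ∀ p,
      p ∈ Set.uIcc ((2 : ℕ) • pos u) ((2 : ℕ) • pos u + gridStep d) →
      p ∈ Set.uIcc ((2 : ℕ) • pos a) ((2 : ℕ) • pos b) →
      (u = a ∨ u = b) ∧ p = (2 : ℕ) • pos u := by
    intro a b ha hb hab p hp hp'
    rcases eq_or_eq_of_mem_uIcc_add_gridStep hp with rfl | rfl
    · exact ⟨D.mem_segment ha hb hu hab (mem_uIcc_of_two_nsmul_mem hp'), rfl⟩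
    · exact absurd hp' (new_notMem a b ha hb hab)
  have two_nsmul_inj : ∀ p q : ℤ × ℤ, (2 : ℕ) • p = (2 : ℕ) • q → p = q := by
    intro p q h
    simp only [Prod.ext_iff, two_nsmul, Prod.fst_add, Prod.snd_add] at h ⊢
    omega
  have on_new : ∀ w, w ≠ x →
      (2 : ℕ) • pos w ∈ Set.uIcc ((2 : ℕ) • pos u) ((2 : ℕ) • pos u + gridStep d) → w = u := by
    intro w hw h
    rcases eq_or_eq_of_mem_uIcc_add_gridStep h with h | h
    · exact D.injOn hw hu (two_nsmul_inj _ _ h)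
    · exact absurd h.symm two_nsmul_add_gridStep_ne
  -- The rotation at the new leaf is free; it is chosen so that `c x u` points back along the edge,
  -- in direction `d + 2`.
  refine ⟨fun v => if v = x then d + 2 - c x u else s v,
    fun v => if v = x then (2 : ℕ) • pos u + gridStep d else (2 : ℕ) • pos v, ?_, ?_, ?_, ?_⟩
  · intro v w _ _ h
    by_cases hv : v = x <;> by_cases hw : w = x <;> simp only [hv, hw, if_true, if_false] at h ⊢
    · exact absurd h two_nsmul_add_gridStep_ne
    · exact absurd h.symm two_nsmul_add_gridStep_ne
    · exact D.injOn hv hw (two_nsmul_inj _ _ h)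
  · intro v w _ _ h
    by_cases hv : v = x
    · subst hv
      obtain rfl := huniq w h
      refine ⟨1, one_pos, ?_⟩
      simp only [hux, if_true, if_false, one_smul]
      rw [add_sub_cancel, gridStep_add_two, add_neg_cancel_right]
    · by_cases hw : w = x
      · subst hw
        obtain rfl := huniq' v h
        exact ⟨1, one_pos, by simp [hux, hd]⟩
      · obtain ⟨l, hl, hlw⟩ := D.edge hv hw h
        refine ⟨2 * l, by omega, ?_⟩
        simp only [hv, hw, if_false, hlw, smul_add]
        rw [mul_smul, ofNat_zsmul]
  · intro v w y _ _ _ h hy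
    by_cases hv : v = x
    · subst hv
      obtain rfl := huniq w h
      by_cases hyv : y = v
      · exact Or.inl hyv
      · simp only [hux, hyv, if_true, if_false] at hy
        exact Or.inr (on_new y hyv (by rwa [Set.uIcc_comm]))
    · by_cases hw : w = x
      · subst hw
        obtain rfl := huniq' v h
        by_cases hyw : y = w
        · exact Or.inr hyw
        · simp only [hux, hyw, if_true, if_false] at hy
          exact Or.inl (on_new y hyw hy)
      · by_cases hyx : y = x
        · simp only [hv, hw, hyx, if_true, if_false] at hy
          exact absurd hy (new_notMem v w hv hw h)
        · simp only [hv, hw, hyx, if_false] at hy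
          exact D.mem_segment hv hw hyx h (mem_uIcc_of_two_nsmul_mem hy)
  · have key : ∀ v y z, v = u → T.Adj y z → s(x, v) ≠ s(y, z) → ∀ p,
        p ∈ Set.uIcc ((2 : ℕ) • pos u) ((2 : ℕ) • pos u + gridStep d) →
        p ∈ Set.uIcc (if y = x then (2 : ℕ) • pos u + gridStep d else (2 : ℕ) • pos y)
          (if z = x then (2 : ℕ) • pos u + gridStep d else (2 : ℕ) • pos z) →
        (u = y ∨ u = z) ∧ p = (2 : ℕ) • pos u := by
      rintro v y z rfl hyz hne p hp hp'
      by_cases hy : y = x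
      · subst hy
        exact absurd (by rw [huniq z hyz]) hne
      · by_cases hz : z = x
        · subst hz
          exact absurd (by rw [huniq' y hyz, Sym2.eq_swap]) hne
        · simp only [hy, hz, if_false] at hp'
          exact new_old y z hy hz hyz p hp hp'
    intro a b y z _ _ _ _ hab hyz hne p hp hp'
    by_cases ha : a = x
    · subst ha
      obtain rfl := huniq b hab
      simp only [hux, if_true, if_false] at hp
      obtain ⟨h1, h2⟩ := key b y z rfl hyz hne p (by rwa [Set.uIcc_comm]) hp'
      exact ⟨b, Or.inr rfl, h1, by simp [hux, h2]⟩
    · by_cases hb : b = x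
      · subst hb
        obtain rfl := huniq' a hab
        simp only [hux, if_true, if_false] at hp
        obtain ⟨h1, h2⟩ := key a y z rfl hyz (by rwa [Sym2.eq_swap]) p hp hp'
        exact ⟨a, Or.inl rfl, h1, by simp [hux, h2]⟩
      · by_cases hy : y = x
        · subst hy
          obtain rfl := huniq z hyz
          simp only [hux, if_true, if_false] at hp'
          obtain ⟨h1, h2⟩ := key z a b rfl hab hne.symm p (by rwa [Set.uIcc_comm]) hp
          exact ⟨z, h1, Or.inr rfl, by simp [hux, h2]⟩
        · by_cases hz : z = x
          · subst hz
            obtain rfl := huniq' y hyz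
            simp only [hux, if_true, if_false] at hp'
            obtain ⟨h1, h2⟩ := key y a b rfl hab (by rw [Sym2.eq_swap]; exact hne.symm) p hp' hp
            exact ⟨y, h1, Or.inl rfl, by simp [hux, h2]⟩
          · simp only [ha, hb, hy, hz, if_false] at hp hp'
            obtain ⟨w, h1, h2, h3⟩ :=
              D.nonintersecting_two_nsmul ha hb hy hz hab hyz hne hp hp'
            have hw : w ≠ x := by rcases h1 with rfl | rfl <;> assumption
            exact ⟨w, h1, h2, by simpa [hw] using h3⟩

theorem DirectedDrawing.of_induce {V : Type u} {T : SimpleGraph V} {c : V → V → ZMod 4}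
    {S : Set V} {s : S → ZMod 4} {pos : S → ℤ × ℤ}
    (D : DirectedDrawing (T.induce S) (fun v w => c v w) Set.univ s pos) :
    ∃ s' pos', DirectedDrawing T c S s' pos' := by
  classical
  refine ⟨fun v => if h : v ∈ S then s ⟨v, h⟩ else 0, fun v => if h : v ∈ S then pos ⟨v, h⟩ else 0,
    ?_, ?_, ?_, ?_⟩
  · intro v w hv hw h
    simp only [hv, hw, dite_true] at h
    simpa using D.injOn trivial trivial h
  · intro v w hv hw h
    simp only [hv, hw, dite_true]
    exact D.edge (v := ⟨v, hv⟩) (w := ⟨w, hw⟩) trivial trivial h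
  · intro v w x hv hw hx h hp
    simp only [hv, hw, hx, dite_true] at hp
    simpa using D.mem_segment (v := ⟨v, hv⟩) (w := ⟨w, hw⟩) (x := ⟨x, hx⟩)
      trivial trivial trivial h hp
  · intro v w x y hv hw hx hy h h' hne p hp hp'
    simp only [hv, hw, hx, hy, dite_true] at hp hp'
    obtain ⟨z, h1, h2, h3⟩ := D.nonintersecting (u := ⟨v, hv⟩) (v := ⟨w, hw⟩) (x := ⟨x, hx⟩)
      (y := ⟨y, hy⟩) trivial trivial trivial trivial h h' (by simpa using hne) p hp hp'
    refine ⟨z, by simpa [Subtype.ext_iff] using h1, by simpa [Subtype.ext_iff] using h2, ?_⟩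
    simpa using h3

theorem SimpleGraph.IsTree.exists_directedDrawing (n : ℕ) : ∀ (V : Type u) [Finite V]
    (T : SimpleGraph V) (c : V → V → ZMod 4), T.IsTree → Nat.card V = n →
    (∀ ⦃v w w'⦄, T.Adj v w → T.Adj v w' → c v w = c v w' → w = w') →
    ∃ s pos, DirectedDrawing T c Set.univ s pos := by
  induction n with
  | zero =>
    intro V _ T c hT hcard _
    have := hT.connected.nonempty
    exact absurd hcard Nat.card_pos.ne'
  | succ n ih =>
    intro V _ T c hT hcard hc
    classical
    cases nonempty_fintype V
    rcases subsingleton_or_nontrivial V with hV | hV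
    · exact ⟨0, 0, fun v w _ _ _ => Subsingleton.elim v w,
        fun v w _ _ h => absurd (Subsingleton.elim v w) h.ne,
        fun v w x _ _ _ _ _ => Or.inl (Subsingleton.elim x v),
        fun u v x y _ _ _ _ h => absurd (Subsingleton.elim u v) h.ne⟩
    · obtain ⟨x, hx⟩ := hT.exists_vert_degree_one_of_nontrivial
      obtain ⟨y, hxy, huniq⟩ := degree_eq_one_iff_existsUnique_adj.1 hx
      have htree : (T.induce {x}ᶜ).IsTree :=
        ⟨hT.connected.induce_compl_singleton_of_degree_eq_one hx, hT.isAcyclic.induce _⟩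
      have hcard' : Nat.card ({x}ᶜ : Set V) = n := by
        rw [Nat.card_coe_set_eq, Set.ncard_compl, Set.ncard_singleton, hcard]
        rfl
      obtain ⟨s, pos, D⟩ := ih ({x}ᶜ : Set V) (T.induce {x}ᶜ) (fun v w => c v w) htree hcard'
        (fun v w w' h h' he => Subtype.ext (hc h h' he))
      obtain ⟨s', pos', D'⟩ := D.of_induce
      exact D'.extend_leaf hc hxy huniq

/-- The directions at the two ends of an edge need not match, since the rotations absorb the
discrepancy. Whether a path bends at `v` depends only on a difference of directions at `v`. -/
theorem SimpleGraph.IsTree.exists_straightModel_of_directions {V : Type u} [Finite V]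
    {T : SimpleGraph V} (hT : T.IsTree) (c : V → V → ZMod 4)
    (hc : ∀ ⦃v w w'⦄, T.Adj v w → T.Adj v w' → c v w = c v w' → w = w') :
    ∃ M : StraightModel T, ∀ ⦃u v w⦄, T.Adj v u → T.Adj v w → M.IsBend u v w →
      c v w ≠ c v u ∧ c v w ≠ c v u + 2 := by
  obtain ⟨s, pos, D⟩ := IsTree.exists_directedDrawing _ V T c hT rfl hc
  have axis : ∀ d : ZMod 4, (gridStep d).1 = 0 ∨ (gridStep d).2 = 0 := by decide
  refine ⟨⟨pos, fun v w h => D.injOn trivial trivial h, ?_, fun u v x y h h' =>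
    D.nonintersecting trivial trivial trivial trivial h h'⟩, ?_⟩
  · intro u v h
    obtain ⟨l, -, hl⟩ := D.edge trivial trivial h
    rcases axis (c u v + s u) with ha | ha <;> simp [hl, ha]
  · intro u v w hu hw hb
    obtain ⟨l, -, hl⟩ := D.edge trivial trivial hu
    obtain ⟨m, -, hm⟩ := D.edge trivial trivial hw
    have bend : ∀ e : ZMod 4, (gridStep e = gridStep (c v u + s v) ∨
        gridStep e = -gridStep (c v u + s v)) → e = c v w + s v → False := by
      rintro e he rfl
      unfold StraightModel.IsBend at hb
      simp only [hl, hm, Prod.fst_add, Prod.snd_add, Prod.smul_fst, Prod.smul_snd] at hb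
      rcases axis (c v u + s v) with ha | ha <;> rcases he with he | he <;>
        simp [he, ha] at hb
    refine ⟨fun h => bend _ (Or.inl rfl) (by rw [h]), fun h => ?_⟩
    refine bend (c v u + s v + 2) (Or.inr (gridStep_add_two _)) (by rw [h]; ring)

/-! ### Optimal models by pairing branches of large rank. -/

theorem BranchRank.mono {V : Type*} {T : SimpleGraph V} {m n : ℕ} {u v : V}
    (h : BranchRank T m u v) (hnm : n ≤ m) : BranchRank T n u v := by
  induction h generalizing n with
  | zero h =>
    obtain rfl := Nat.le_zero.1 hnm
    exact .zero h
  | step h hw _ ih => exact .step h hw (ih hnm)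
  | branch h hw hw' hne _ _ ih₁ ih₂ =>
    cases n with
    | zero => exact .zero h
    | succ n =>
      exact .branch h hw hw' hne (ih₁ (Nat.le_of_succ_le_succ hnm)) (ih₂ (Nat.le_of_succ_le_succ hnm))

theorem BranchRank.le_card {V : Type*} [Finite V] {T : SimpleGraph V} (hT : T.IsAcyclic)
    {n : ℕ} {u v : V} (h : BranchRank T n u v) : n ≤ Nat.card V := by
  have h1 := h.two_pow_add_two_pow_le_card hT (.zero h.adj.symm)
  have h2 := (n + 1).lt_two_pow_self
  omega

/-- The Horton–Strahler rank of the branch of `T` behind the edge `uv`, seen from `u`. -/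
noncomputable def branchRank {V : Type*} (T : SimpleGraph V) (u v : V) : ℕ :=
  sSup {n | BranchRank T n u v}

theorem BranchRank.le_branchRank {V : Type*} [Finite V] {T : SimpleGraph V}
    (hT : T.IsAcyclic) {n : ℕ} {u v : V} (h : BranchRank T n u v) :
    n ≤ branchRank T u v :=
  le_csSup ⟨Nat.card V, fun _ h => BranchRank.le_card hT h⟩ h

theorem branchRank_spec {V : Type*} [Finite V] {T : SimpleGraph V}
    (hT : T.IsAcyclic) {u v : V} (h : T.Adj u v) : BranchRank T (branchRank T u v) u v :=
  Nat.sSup_mem (s := {n | BranchRank T n u v}) ⟨0, BranchRank.zero h⟩ ⟨Nat.card V, fun _ h => BranchRank.le_card hT h⟩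

theorem branchRank_le_branchRank {V : Type*} [Finite V] {T : SimpleGraph V}
    (hT : T.IsAcyclic) {u v w : V} (huv : T.Adj u v) (hvw : T.Adj v w) (hwu : w ≠ u) :
    branchRank T v w ≤ branchRank T u v :=
  BranchRank.le_branchRank hT (.step huv hwu (branchRank_spec hT hvw))

theorem lt_branchRank {V : Type*} [Finite V] {T : SimpleGraph V}
    (hT : T.IsAcyclic) {n : ℕ} {u v w w' : V} (huv : T.Adj u v) (hvw : T.Adj v w)
    (hvw' : T.Adj v w') (hwu : w ≠ u) (hwu' : w' ≠ u) (hne : w ≠ w') (hn : n ≤ branchRank T v w)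
    (hn' : n ≤ branchRank T v w') : n < branchRank T u v :=
  BranchRank.le_branchRank hT (.branch huv hwu hwu' hne ((branchRank_spec hT hvw).mono hn)
    ((branchRank_spec hT hvw').mono hn'))

/-- The two largest elements form one opposite pair and the rest the other. If `a` and `b` belong to
different pairs, one of the two largest differs from both and is at least the smaller of them. -/
theorem Finset.exists_opposite_pairing {V : Type*} (S : Finset V) (hS : S.card ≤ 4) (f : V → ℕ) :
    ∃ g : V → ZMod 4, (∀ a ∈ S, ∀ b ∈ S, g a = g b → a = b) ∧
      ∀ a ∈ S, ∀ b ∈ S, g b ≠ g a → g b ≠ g a + 2 → f a ≤ f b →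
        ∃ p ∈ S, p ≠ a ∧ p ≠ b ∧ f a ≤ f p := by
  classical
  rcases S.eq_empty_or_nonempty with rfl | hne
  · exact ⟨0, by simp, by simp⟩
  obtain ⟨x, hx, hxmax⟩ := S.exists_max_image f hne
  rcases (S.erase x).eq_empty_or_nonempty with he | hne'
  · refine ⟨0, ?_, fun _ _ _ _ h => absurd rfl h⟩
    intro a ha b hb _
    rw [Finset.erase_eq_empty_iff] at he
    rcases he with rfl | rfl <;> simp_all
  obtain ⟨y, hy, hymax⟩ := (S.erase x).exists_max_image f hne'
  have hcard : ((S.erase x).erase y).card ≤ 2 := by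
    rw [Finset.card_erase_of_mem hy, Finset.card_erase_of_mem hx]
    omega
  -- `z` only separates the at most two remaining elements; any value does if none remain.
  obtain ⟨z, hz⟩ : ∃ z, ∀ a ∈ (S.erase x).erase y, ∀ b ∈ (S.erase x).erase y,
      a ≠ z → b ≠ z → a = b := by
    rcases ((S.erase x).erase y).eq_empty_or_nonempty with he | ⟨z, hz⟩
    · exact ⟨x, by simp [he]⟩
    · refine ⟨z, fun a ha b hb haz hbz => ?_⟩
      have : (((S.erase x).erase y).erase z).card ≤ 1 := by
        rw [Finset.card_erase_of_mem hz]
        omega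
      exact Finset.card_le_one.1 this a (Finset.mem_erase.2 ⟨haz, ha⟩) b
        (Finset.mem_erase.2 ⟨hbz, hb⟩)
  simp only [Finset.mem_erase] at hy hz hymax
  have h22 : (2 : ZMod 4) + 2 = 0 := by decide
  refine ⟨fun a => if a = x then 0 else if a = y then 2 else if a = z then 1 else 3, ?_, ?_⟩
  · intro a ha b hb h
    dsimp only at h
    split_ifs at h <;> first | exact absurd h (by decide) | grind
  · intro a ha b hb h1 h2 hab
    by_cases hax : a = x
    · refine ⟨y, hy.2, by rw [hax]; exact hy.1, ?_, ?_⟩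
      · rintro rfl
        simp [hax, hy.1] at h2
      · have hbx : b ≠ x := by
          rintro rfl
          simp [hax] at h1
        exact hab.trans (hymax b ⟨hbx, hb⟩)
    · by_cases hbx : b = x
      · refine ⟨y, hy.2, ?_, by rw [hbx]; exact hy.1, hymax a ⟨hax, ha⟩⟩
        rintro rfl
        simp [hbx, hy.1, h22] at h2
      · exact ⟨x, hx, Ne.symm hax, Ne.symm hbx, hxmax a ha⟩

/-- Along a path the rank ahead never grows and the rank behind never falls. A bend makes the rank
behind rise while it is the smaller at the vertex, and the rank ahead drop afterwards. -/
theorem SimpleGraph.IsTree.exists_bends_le {V : Type*} [Finite V] {T : SimpleGraph V}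
    (hT : T.IsTree) (hdeg : ∀ v, (T.neighborSet v).encard ≤ 4) {k : ℕ}
    (hk : ∀ ⦃u v⦄, T.Adj u v → branchRank T u v + branchRank T v u ≤ k) :
    ∃ M : StraightModel T, M.bends ≤ k := by
  classical
  cases nonempty_fintype V
  have hA := hT.isAcyclic
  have hcol : ∀ v : V, ∃ g : V → ZMod 4,
      (∀ a ∈ T.neighborFinset v, ∀ b ∈ T.neighborFinset v, g a = g b → a = b) ∧
      ∀ a ∈ T.neighborFinset v, ∀ b ∈ T.neighborFinset v, g b ≠ g a → g b ≠ g a + 2 →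
        branchRank T v a ≤ branchRank T v b →
        ∃ p ∈ T.neighborFinset v, p ≠ a ∧ p ≠ b ∧ branchRank T v a ≤ branchRank T v p := by
    intro v
    refine Finset.exists_opposite_pairing _ ?_ _
    have := hdeg v
    rw [← coe_neighborFinset, Set.encard_coe_eq_coe_finsetCard] at this
    exact_mod_cast this
  choose c hinj hpair using hcol
  simp only [mem_neighborFinset] at hinj hpair
  obtain ⟨M, hM⟩ := hT.exists_straightModel_of_directions c
    (fun v w w' h h' he => hinj v w h w' h' he)
  -- The pairing supplies a third branch at `v` of rank at least that of `u`; together they raise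
  -- the rank seen from `w`.
  have bend_le : ∀ ⦃u v w⦄, T.Adj v u → T.Adj v w → M.IsBend u v w →
      branchRank T v u ≤ branchRank T v w → branchRank T v u < branchRank T w v := by
    intro u v w hu hw hb hle
    obtain ⟨h1, h2⟩ := hM hu hw hb
    obtain ⟨p, hp, hpu, hpw, hup⟩ := hpair v u hu w hw h1 h2 hle
    have huw : u ≠ w := fun h => h1 (by rw [h])
    exact lt_branchRank hA hw.symm hu hp huw hpw hpu.symm le_rfl hup
  have bend_ge : ∀ ⦃u v w⦄, T.Adj v u → T.Adj v w → M.IsBend u v w →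
      branchRank T v w ≤ branchRank T v u → branchRank T v w < branchRank T u v :=
    fun u v w hu hw hb hle => bend_le hw hu (M.isBend_comm.1 hb) hle
  -- Once the rank ahead is at most the rank behind, this persists and each bend lowers the rank
  -- ahead.
  have descending : ∀ (l : List V) (u v : V), (u :: v :: l).IsChain T.Adj → (u :: v :: l).Nodup →
      branchRank T u v ≤ branchRank T v u → M.bendsAlong (u :: v :: l) ≤ branchRank T u v := by
    intro l
    induction l with
    | nil => intro u v _ _ _; simp [StraightModel.bendsAlong]
    | cons w l ih =>
      intro u v hch hnd hle
      simp only [List.isChain_cons_cons] at hch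
      obtain ⟨huv, hvw, hch⟩ := hch
      have hwu : w ≠ u := by
        rintro rfl
        simp at hnd
      have h1 := branchRank_le_branchRank hA huv hvw hwu
      have h2 := branchRank_le_branchRank hA hvw.symm huv.symm hwu.symm
      have h3 := ih v w (List.isChain_cons_cons.2 ⟨hvw, hch⟩) hnd.of_cons (by omega)
      rw [StraightModel.bendsAlong]
      split_ifs with hb
      · have := bend_ge huv.symm hvw hb (by omega)
        omega
      · omega
  have total : ∀ (l : List V) (u v : V), (u :: v :: l).IsChain T.Adj → (u :: v :: l).Nodup →
      branchRank T v u + M.bendsAlong (u :: v :: l) ≤ k := by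
    intro l
    induction l with
    | nil =>
      intro u v hch _
      have := hk (List.isChain_cons_cons.1 hch).1
      simp only [StraightModel.bendsAlong]
      omega
    | cons w l ih =>
      intro u v hch hnd
      simp only [List.isChain_cons_cons] at hch
      obtain ⟨huv, hvw, hch⟩ := hch
      have hwu : w ≠ u := by
        rintro rfl
        simp at hnd
      have hch' : (v :: w :: l).IsChain T.Adj := List.isChain_cons_cons.2 ⟨hvw, hch⟩
      have h2 := branchRank_le_branchRank hA hvw.symm huv.symm hwu.symm
      have h3 := ih v w hch' hnd.of_cons
      rw [StraightModel.bendsAlong]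
      split_ifs with hb
      · rcases le_total (branchRank T v u) (branchRank T v w) with hle | hle
        · have := bend_le huv.symm hvw hb hle
          omega
        · have h4 := bend_ge huv.symm hvw hb hle
          have h5 := descending l v w hch' hnd.of_cons (by omega)
          have h6 := hk huv
          omega
      · omega
  refine ⟨M, csSup_le' ?_⟩
  rintro n ⟨u, v, p, -, -, hp, rfl⟩
  have hch := p.isChain_adj_support
  have hnd := hp.support_nodup
  match hl : p.support with
  | [] => simp [StraightModel.bendsAlong]
  | [x] => simp [StraightModel.bendsAlong]
  | x :: y :: l =>
    rw [hl] at hch hnd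
    have := total l x y hch hnd
    omega

theorem SimpleGraph.IsTree.exists_branchRank_of_le_bendNumber {V : Type*} [Finite V]
    {T : SimpleGraph V} (hT : T.IsTree) (hdeg : ∀ v, (T.neighborSet v).encard ≤ 4) {k : ℕ}
    (hk : k + 1 ≤ bendNumber T) :
    ∃ m n u v, k + 1 ≤ m + n ∧ BranchRank T m u v ∧ BranchRank T n v u := by
  by_contra! hcon
  obtain ⟨M, hM⟩ := hT.exists_bends_le hdeg (k := k) (by
    intro u v h
    by_contra! hlt
    exact hcon _ _ u v hlt (branchRank_spec hT.isAcyclic h) (branchRank_spec hT.isAcyclic h.symm))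
  have : bendNumber T ≤ M.bends := Nat.sInf_le ⟨M, rfl⟩
  omega

/-- Any crude bound on the ranks will do. Existence matters because `bendNumber` would be `0` by
default if there were no model. -/
theorem SimpleGraph.IsTree.nonempty_straightModel {V : Type*} [Finite V] {T : SimpleGraph V}
    (hT : T.IsTree) (hdeg : ∀ v, (T.neighborSet v).encard ≤ 4) : Nonempty (StraightModel T) := by
  obtain ⟨M, -⟩ := hT.exists_bends_le hdeg (k := Nat.card V + Nat.card V)
    (fun u v h => add_le_add ((branchRank_spec hT.isAcyclic h).le_card hT.isAcyclic)
      ((branchRank_spec hT.isAcyclic h.symm).le_card hT.isAcyclic))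
  exact ⟨M⟩

theorem BranchRank.add_le_bendNumber {V : Type*} [Finite V] {T : SimpleGraph V} (hT : T.IsAcyclic)
    (hM : Nonempty (StraightModel T)) {m n : ℕ} {u v : V} (h : BranchRank T m u v)
    (h' : BranchRank T n v u) : m + n ≤ bendNumber T := by
  obtain ⟨M, hM⟩ := Nat.sInf_mem (s := {n | ∃ M : StraightModel T, n = M.bends})
    (hM.elim fun M => ⟨_, M, rfl⟩)
  exact (h.add_le_bends hT M h').trans hM.ge

/-! ### The tree `T_k` and its ranks. -/

section Parent

variable {V : Type*} {G : SimpleGraph V} {r : V} {parent : V → V} {depth : V → ℕ}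

/-- Following parents leads to `r`, and each edge comes from a vertex other than `r`, so there are
at most `|V| - 1` edges. -/
theorem SimpleGraph.isTree_of_parent [Finite V]
    (hadj : ∀ v w, G.Adj v w ↔ (v ≠ r ∧ w = parent v) ∨ (w ≠ r ∧ v = parent w))
    (hdepth : ∀ v, v ≠ r → depth (parent v) < depth v) : G.IsTree := by
  have hreach : ∀ n v, depth v ≤ n → G.Reachable v r := by
    intro n
    induction n with
    | zero =>
      intro v hv
      by_cases hr : v = r
      · rw [hr]
      · have := hdepth v hr
        omega
    | succ n ih =>
      intro v hv
      by_cases hr : v = r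
      · rw [hr]
      · have h : G.Adj v (parent v) := (hadj _ _).2 (Or.inl ⟨hr, rfl⟩)
        exact h.reachable.trans (ih _ (by have := hdepth v hr; omega))
  have hconn : G.Connected :=
    { preconnected := fun v w => (hreach _ v le_rfl).trans (hreach _ w le_rfl).symm
      nonempty := ⟨r⟩ }
  refine isTree_iff_connected_and_card.2 ⟨hconn, le_antisymm ?_
    hconn.card_vert_le_card_edgeSet_add_one⟩
  have hsurj : Function.Surjective (fun v : {v // v ≠ r} =>
      (⟨s(v.1, parent v.1), (hadj _ _).2 (Or.inl ⟨v.2, rfl⟩)⟩ : G.edgeSet)) := by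
    rintro ⟨e, he⟩
    induction e with
    | _ v w =>
      rcases (hadj v w).1 he with ⟨hv, rfl⟩ | ⟨hw, rfl⟩
      · exact ⟨⟨v, hv⟩, rfl⟩
      · exact ⟨⟨w, hw⟩, Subtype.ext Sym2.eq_swap⟩
  have h1 : Nat.card G.edgeSet ≤ Nat.card {v // v ≠ r} :=
    Nat.card_le_card_of_surjective _ hsurj
  have h2 : Nat.card {v // v ≠ r} + 1 = Nat.card V := by
    have h3 : Nat.card {v // v ≠ r} = Nat.card V - 1 := by
      have := Set.ncard_compl {r}
      rwa [Set.ncard_singleton, ← Nat.card_coe_set_eq] at this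
    have h4 : 0 < Nat.card V := @Nat.card_pos V ⟨r⟩ _
    omega
  exact h2 ▸ Nat.succ_le_succ h1

theorem SimpleGraph.encard_neighborSet_le_of_parent
    (hadj : ∀ v w, G.Adj v w ↔ (v ≠ r ∧ w = parent v) ∨ (w ≠ r ∧ v = parent w))
    (label : V → Bool)
    (hlabel : ∀ v w, v ≠ r → w ≠ r → parent v = parent w → label v = label w → v = w) (v : V) :
    (G.neighborSet v).encard ≤ 4 := by
  have hsub : G.neighborSet v ⊆ {parent v} ∪ {w | w ≠ r ∧ v = parent w} := by
    intro w hw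
    rcases (hadj v w).1 hw with h | h
    · exact Or.inl h.2
    · exact Or.inr h
  have hinj : Set.InjOn label {w | w ≠ r ∧ v = parent w} :=
    fun a ha b hb h => hlabel a b ha.1 hb.1 (ha.2.symm.trans hb.2) h
  have h1 : {w | w ≠ r ∧ v = parent w}.encard ≤ 2 := by
    refine (Set.encard_le_encard_of_injOn (t := Set.univ) (fun _ _ => trivial) hinj).trans ?_
    rw [Set.encard_univ, ENat.card_eq_coe_fintype_card, Fintype.card_bool]
    rfl
  calc (G.neighborSet v).encard ≤ ({parent v} ∪ {w | w ≠ r ∧ v = parent w}).encard :=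
        Set.encard_le_encard hsub
    _ ≤ ({parent v} : Set V).encard + {w | w ≠ r ∧ v = parent w}.encard := Set.encard_union_le _ _
    _ ≤ 1 + 2 := add_le_add (by simp) h1
    _ ≤ 4 := by norm_num

end Parent

namespace BranchedPath

/-- The root `v_0` of the path with attached binary trees. -/
def root (k : ℕ) : BranchedPathVertex k := Sum.inl 0

/-- The neighbour of a vertex on the way to `v_0`. -/
def parent {k : ℕ} : BranchedPathVertex k → BranchedPathVertex k
  -- At `v_0` truncated subtraction returns `v_0` itself.
  | Sum.inl j => Sum.inl ⟨j.val - 1, by omega⟩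
  | Sum.inr ⟨i, ⟨[], _⟩⟩ => Sum.inl ⟨i.val + 1, by omega⟩
  | Sum.inr ⟨i, ⟨_ :: l, h⟩⟩ => Sum.inr ⟨i, ⟨l, (Nat.le_succ _).trans h⟩⟩

/-- The distance of a vertex from `v_0`. -/
def depth {k : ℕ} : BranchedPathVertex k → ℕ
  | Sum.inl j => j.val
  | Sum.inr ⟨i, x⟩ => i.val + 2 + x.1.length

/-- A label that distinguishes the children of a vertex. -/
def label {k : ℕ} : BranchedPathVertex k → Bool
  | Sum.inl _ => false
  | Sum.inr ⟨_, ⟨[], _⟩⟩ => true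
  | Sum.inr ⟨_, ⟨c :: _, _⟩⟩ => c

theorem inl_ne_root {k : ℕ} {j : Fin (k + 2)} (h : j.val ≠ 0) :
    (Sum.inl j : BranchedPathVertex k) ≠ root k := by
  intro hj
  apply h
  rw [Sum.inl.inj hj]
  rfl

theorem inr_ne_root {k : ℕ} (x) : (Sum.inr x : BranchedPathVertex k) ≠ root k := nofun

theorem depth_parent_lt {k : ℕ} (v : BranchedPathVertex k) (hv : v ≠ root k) :
    depth (parent v) < depth v := by
  match v, hv with
  | Sum.inl j, hv =>
    have : j.val ≠ 0 := fun h => hv (congrArg Sum.inl (Fin.ext h))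
    simp only [parent, depth]
    omega
  | Sum.inr ⟨i, ⟨[], _⟩⟩, _ => simp only [parent, depth]; omega
  | Sum.inr ⟨i, ⟨c :: l, _⟩⟩, _ => simp only [parent, depth, List.length_cons]; omega

theorem rel_parent {k : ℕ} (v : BranchedPathVertex k) (hv : v ≠ root k) :
    BranchedPathRel k (parent v) v := by
  match v, hv with
  | Sum.inl j, hv =>
    have : j.val ≠ 0 := fun h => hv (congrArg Sum.inl (Fin.ext h))
    exact .path _ _ (by simp only; omega)
  | Sum.inr ⟨i, ⟨[], _⟩⟩, _ => exact .attach i _ rfl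
  | Sum.inr ⟨i, ⟨c :: l, _⟩⟩, _ =>
    refine .branch i _ _ ?_
    rw [fullBinaryTree, fromRel_adj]
    exact ⟨fun h => by simpa using congrArg Subtype.val h, Or.inl ⟨c, rfl⟩⟩

theorem eq_parent_of_rel {k : ℕ} {v w : BranchedPathVertex k} (h : BranchedPathRel k v w) :
    (v ≠ root k ∧ w = parent v) ∨ (w ≠ root k ∧ v = parent w) := by
  cases h with
  | path i j h =>
    refine Or.inr ⟨inl_ne_root (by omega), congrArg Sum.inl (Fin.ext ?_)⟩
    simp only
    omega
  | attach i j h => exact Or.inr ⟨inr_ne_root _, congrArg Sum.inl (Fin.ext h)⟩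
  | branch i x y h =>
    rw [fullBinaryTree, fromRel_adj] at h
    obtain ⟨-, ⟨c, hc⟩ | ⟨c, hc⟩⟩ := h
    · obtain ⟨y, hy⟩ := y
      obtain rfl : y = c :: x.1 := hc
      exact Or.inr ⟨inr_ne_root _, rfl⟩
    · obtain ⟨x, hx⟩ := x
      obtain rfl : x = c :: y.1 := hc
      exact Or.inl ⟨inr_ne_root _, rfl⟩

theorem adj_iff {k : ℕ} (v w : BranchedPathVertex k) : (branchedPath k).Adj v w ↔
    (v ≠ root k ∧ w = parent v) ∨ (w ≠ root k ∧ v = parent w) := by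
  rw [branchedPath, fromRel_adj]
  constructor
  · rintro ⟨-, h | h⟩
    · exact eq_parent_of_rel h
    · exact (eq_parent_of_rel h).symm
  · have hne : ∀ v : BranchedPathVertex k, v ≠ root k → parent v ≠ v :=
      fun v hv h => (depth_parent_lt v hv).ne (congrArg depth h)
    rintro (⟨hv, rfl⟩ | ⟨hw, rfl⟩)
    · exact ⟨(hne v hv).symm, Or.inr (rel_parent v hv)⟩
    · exact ⟨hne w hw, Or.inl (rel_parent w hw)⟩

theorem eq_of_parent_eq {k : ℕ} (v w : BranchedPathVertex k) (hv : v ≠ root k) (hw : w ≠ root k)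
    (h : parent v = parent w) (hl : label v = label w) : v = w := by
  match v, w, hv, hw, h, hl with
  | Sum.inl i, Sum.inl j, hv, hw, h, _ =>
    have h1 : i.val ≠ 0 := fun h => hv (congrArg Sum.inl (Fin.ext h))
    have h2 : j.val ≠ 0 := fun h => hw (congrArg Sum.inl (Fin.ext h))
    have h3 : i.val - 1 = j.val - 1 := congrArg Fin.val (Sum.inl.inj h)
    exact congrArg Sum.inl (Fin.ext (by omega))
  | Sum.inl i, Sum.inr ⟨j, ⟨[], _⟩⟩, _, _, _, hl => cases hl
  | Sum.inl i, Sum.inr ⟨j, ⟨c :: l, _⟩⟩, _, _, h, _ => cases h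
  | Sum.inr ⟨j, ⟨[], _⟩⟩, Sum.inl i, _, _, _, hl => cases hl
  | Sum.inr ⟨j, ⟨c :: l, _⟩⟩, Sum.inl i, _, _, h, _ => cases h
  | Sum.inr ⟨i, ⟨[], _⟩⟩, Sum.inr ⟨j, ⟨[], _⟩⟩, _, _, h, _ =>
    have h3 : i.val + 1 = j.val + 1 := congrArg Fin.val (Sum.inl.inj h)
    obtain rfl : i = j := Fin.ext (by omega)
    rfl
  | Sum.inr ⟨i, ⟨[], _⟩⟩, Sum.inr ⟨j, ⟨c :: l, _⟩⟩, _, _, h, _ => cases h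
  | Sum.inr ⟨j, ⟨c :: l, _⟩⟩, Sum.inr ⟨i, ⟨[], _⟩⟩, _, _, h, _ => cases h
  | Sum.inr ⟨i, ⟨c :: l, _⟩⟩, Sum.inr ⟨j, ⟨c' :: l', _⟩⟩, _, _, h, hl =>
    obtain rfl : c = c' := hl
    simp only [parent] at h
    cases h
    rfl

theorem isTree (k : ℕ) : (branchedPath k).IsTree :=
  isTree_of_parent adj_iff depth_parent_lt

theorem encard_neighborSet_le (k : ℕ) (v : BranchedPathVertex k) :
    ((branchedPath k).neighborSet v).encard ≤ 4 :=
  encard_neighborSet_le_of_parent adj_iff label eq_of_parent_eq v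

theorem adj_parent {k : ℕ} {v : BranchedPathVertex k} (hv : v ≠ root k) :
    (branchedPath k).Adj (parent v) v := (adj_iff _ _).2 (Or.inr ⟨hv, rfl⟩)

theorem branchRank_binary {k : ℕ} (i : Fin k) (n : ℕ) :
    ∀ (l : List Bool) (h : l.length + n ≤ branchHeight k (i.val + 1)),
      BranchRank (branchedPath k) n (parent (Sum.inr ⟨i, ⟨l, by omega⟩⟩))
        (Sum.inr ⟨i, ⟨l, by omega⟩⟩) := by
  induction n with
  | zero => exact fun l h => .zero (adj_parent (inr_ne_root _))
  | succ n ih =>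
    intro l h
    have hne : ∀ c, (Sum.inr ⟨i, ⟨c :: l, by rw [List.length_cons]; omega⟩⟩ :
        BranchedPathVertex k) ≠ parent (Sum.inr ⟨i, ⟨l, by omega⟩⟩) := by
      intro c hc
      have h1 := depth_parent_lt (k := k) (Sum.inr ⟨i, ⟨l, by omega⟩⟩) (inr_ne_root _)
      rw [← hc] at h1
      simp only [depth, List.length_cons] at h1
      omega
    exact .branch (adj_parent (inr_ne_root _)) (hne false) (hne true) (by simp)
      (ih (false :: l) (by rw [List.length_cons]; omega))
      (ih (true :: l) (by rw [List.length_cons]; omega))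

theorem branchRank_attached {k : ℕ} (i n : ℕ) (hi : i < k) (hn : n ≤ branchHeight k (i + 1)) :
    BranchRank (branchedPath k) n (Sum.inl ⟨i + 1, by omega⟩)
      (Sum.inr ⟨⟨i, hi⟩, fullBinaryRoot _⟩) :=
  branchRank_binary ⟨i, hi⟩ n [] (by simpa using hn)

theorem adj_path {k : ℕ} (i : ℕ) (hi : i < k + 1) :
    (branchedPath k).Adj (Sum.inl ⟨i, by omega⟩) (Sum.inl ⟨i + 1, by omega⟩) :=
  adj_parent (v := Sum.inl ⟨i + 1, by omega⟩) (inl_ne_root (by simp))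

/-- In the first half of the path the tree at `v_(i+1)` has height `i`, equal to the rank already
accumulated, so each path vertex adds one. -/
theorem branchRank_backward {k : ℕ} (i : ℕ) (hi : i < k + 1) (hik : 2 * i ≤ k + 1) :
    BranchRank (branchedPath k) i (Sum.inl ⟨i + 1, by omega⟩) (Sum.inl ⟨i, by omega⟩) := by
  induction i with
  | zero => exact .zero (adj_path 0 hi).symm
  | succ i ih =>
    refine .branch (adj_path (i + 1) hi).symm ?_ ?_ ?_ (ih (by omega) (by omega))
      (branchRank_attached i i (by omega) ?_)
    · simp; omega
    · simp
    · simp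
    · rw [branchHeight]
      omega

theorem branchRank_forward {k : ℕ} (n i : ℕ) (hi : i + n = k) (hik : k ≤ 2 * i + 1) :
    BranchRank (branchedPath k) n (Sum.inl ⟨i, by omega⟩) (Sum.inl ⟨i + 1, by omega⟩) := by
  induction n generalizing i with
  | zero => exact .zero (adj_path i (by omega))
  | succ n ih =>
    refine .branch (adj_path i (by omega)) ?_ ?_ ?_ (ih (i + 1) (by omega) (by omega))
      (branchRank_attached i n (by omega) ?_)
    · simp; omega
    · simp
    · simp
    · rw [branchHeight]
      omega

/-- The edge after `v_(⌊k/2⌋)` has rank `⌊k/2⌋` on one side and `k - ⌊k/2⌋` on the other. -/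
theorem le_bendNumber (k : ℕ) : k ≤ bendNumber (branchedPath k) := by
  have hM := (isTree k).nonempty_straightModel (encard_neighborSet_le k)
  have h := (branchRank_forward (k := k) (k - k / 2) (k / 2) (by omega) (by omega)).add_le_bendNumber
    (isTree k).isAcyclic hM (branchRank_backward (k / 2) (by omega) (by omega))
  omega

end BranchedPath

/-! ### The order of `T_k` and the extremal bound. -/

/-- A nonempty word of length at most `d + 1` is a letter followed by a word of length at most
`d`. -/
def fullBinaryVertexSuccEquiv (d : ℕ) :
    FullBinaryVertex (d + 1) ≃ Option (Bool × FullBinaryVertex d) where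
  toFun
    | ⟨[], _⟩ => none
    | ⟨c :: l, h⟩ => some (c, ⟨l, Nat.le_of_succ_le_succ h⟩)
  invFun
    | none => ⟨[], Nat.zero_le _⟩
    | some (c, l) => ⟨c :: l.1, Nat.succ_le_succ l.2⟩
  left_inv := by rintro ⟨_ | ⟨c, l⟩, h⟩ <;> rfl
  right_inv := by rintro (_ | ⟨c, l⟩) <;> rfl

theorem card_fullBinaryVertex (d : ℕ) : Nat.card (FullBinaryVertex d) + 1 = 2 ^ (d + 1) := by
  induction d with
  | zero =>
    have : Nat.card (FullBinaryVertex 0) = 1 := by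
      rw [Nat.card_eq_one_iff_unique]
      refine ⟨⟨fun a b => Subtype.ext ?_⟩, ⟨fullBinaryRoot 0⟩⟩
      rw [List.length_eq_zero_iff.1 (Nat.le_zero.1 a.2), List.length_eq_zero_iff.1 (Nat.le_zero.1 b.2)]
    rw [this]
    norm_num
  | succ d ih =>
    rw [Nat.card_congr (fullBinaryVertexSuccEquiv d), Finite.card_option, Nat.card_prod,
      Nat.card_eq_fintype_card, Fintype.card_bool, pow_succ, ← ih]
    ring

theorem card_branchedPathVertex (k : ℕ) : Nat.card (BranchedPathVertex k) =
    (∑ i ∈ Finset.range k, 2 ^ (min i (k - (i + 1)) + 1)) + 2 := by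
  rw [Nat.card_sum, Nat.card_eq_fintype_card, Fintype.card_fin, Nat.card_sigma,
    ← Fin.sum_univ_eq_sum_range (fun i => 2 ^ (min i (k - (i + 1)) + 1)) k]
  have : ∀ i : Fin k, 2 ^ (min i.val (k - (i.val + 1)) + 1) =
      Nat.card (FullBinaryVertex (branchHeight k (i.val + 1))) + 1 := by
    intro i
    rw [card_fullBinaryVertex, branchHeight, Nat.add_sub_cancel]
  simp only [this, Finset.sum_add_distrib, Finset.sum_const, Finset.card_univ, Fintype.card_fin,
    smul_eq_mul, mul_one]
  omega

/-- The two outermost terms are `2` each, and every inner exponent exceeds the corresponding one for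
`k` by one. -/
theorem sum_two_pow_min_add_two (k : ℕ) :
    ∑ i ∈ Finset.range (k + 2), 2 ^ (min i (k + 2 - (i + 1)) + 1) =
      2 * (∑ i ∈ Finset.range k, 2 ^ (min i (k - (i + 1)) + 1)) + 4 := by
  rw [Finset.sum_range_succ, Finset.sum_range_succ', Finset.mul_sum]
  have : ∀ i ∈ Finset.range k, 2 ^ (min (i + 1) (k + 2 - (i + 1 + 1)) + 1) =
      2 * 2 ^ (min i (k - (i + 1)) + 1) := by
    intro i hi
    rw [Finset.mem_range] at hi
    rw [← pow_succ']
    congr 2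
    omega
  rw [Finset.sum_congr rfl this]
  simp

theorem card_branchedPathVertex_even (m : ℕ) :
    Nat.card (BranchedPathVertex (2 * m)) + 2 = 2 ^ (m + 2) := by
  rw [card_branchedPathVertex]
  induction m with
  | zero => simp
  | succ m ih =>
    rw [Nat.mul_succ, sum_two_pow_min_add_two]
    rw [pow_succ _ (m + 2)]
    omega

theorem card_branchedPathVertex_odd (m : ℕ) :
    Nat.card (BranchedPathVertex (2 * m + 1)) + 2 = 3 * 2 ^ (m + 1) := by
  rw [card_branchedPathVertex]
  induction m with
  | zero => simp
  | succ m ih =>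
    rw [show 2 * (m + 1) + 1 = 2 * m + 1 + 2 by ring, sum_two_pow_min_add_two]
    rw [pow_succ _ (m + 1)]
    omega

theorem two_mul_two_pow_le {a b c : ℕ} (h : 2 * c ≤ a + b) : 2 * 2 ^ c ≤ 2 ^ a + 2 ^ b := by
  have key : ∀ d : ℕ, c + 1 ≤ d → 2 * 2 ^ c ≤ 2 ^ d := fun d hd => by
    rw [← pow_succ']
    exact Nat.pow_le_pow_right two_pos hd
  rcases lt_or_ge a c with ha | ha
  · exact (key b (by omega)).trans (Nat.le_add_left _ _)
  rcases lt_or_ge b c with hb | hb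
  · exact (key a (by omega)).trans (Nat.le_add_right _ _)
  · have h1 : 2 ^ c ≤ 2 ^ a := Nat.pow_le_pow_right two_pos ha
    have h2 : 2 ^ c ≤ 2 ^ b := Nat.pow_le_pow_right two_pos hb
    omega

theorem three_mul_two_pow_le {a b c : ℕ} (h : 2 * c + 1 ≤ a + b) : 3 * 2 ^ c ≤ 2 ^ a + 2 ^ b := by
  wlog hab : a ≤ b generalizing a b
  · rw [add_comm]
    exact this (by omega) (by omega)
  rcases lt_or_ge a c with ha | ha
  · have h1 : 2 ^ (c + 2) ≤ 2 ^ b := Nat.pow_le_pow_right two_pos (by omega)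
    have h2 := Nat.two_pow_pos a
    rw [pow_add] at h1
    omega
  · have h1 : 2 ^ c ≤ 2 ^ a := Nat.pow_le_pow_right two_pos ha
    have h2 : 2 ^ (c + 1) ≤ 2 ^ b := Nat.pow_le_pow_right two_pos (by omega)
    rw [pow_succ] at h2
    omega

theorem SimpleGraph.IsTree.two_pow_le_card_of_le_bendNumber {V : Type*} [Finite V]
    {T : SimpleGraph V} (hT : T.IsTree) (hdeg : ∀ v, (T.neighborSet v).encard ≤ 4) {m : ℕ}
    (hm : m ≠ 0) (h : 2 * m ≤ bendNumber T) : 2 ^ (m + 2) ≤ Nat.card V + 2 := by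
  obtain ⟨a, b, u, v, hab, ha, hb⟩ :=
    -- Here `m ≠ 0` is essential: for `m = 0` the one-vertex tree violates the bound.
    hT.exists_branchRank_of_le_bendNumber hdeg (k := 2 * m - 1) (by omega)
  have h1 := ha.two_pow_add_two_pow_le_card hT.isAcyclic hb
  have h2 := two_mul_two_pow_le (a := a + 1) (b := b + 1) (c := m + 1) (by omega)
  rw [← pow_succ'] at h2
  exact h2.trans h1

theorem SimpleGraph.IsTree.three_mul_two_pow_le_card_of_le_bendNumber {V : Type*} [Finite V]
    {T : SimpleGraph V} (hT : T.IsTree) (hdeg : ∀ v, (T.neighborSet v).encard ≤ 4) {m : ℕ}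
    (h : 2 * m + 1 ≤ bendNumber T) : 3 * 2 ^ (m + 1) ≤ Nat.card V + 2 := by
  obtain ⟨a, b, u, v, hab, ha, hb⟩ := hT.exists_branchRank_of_le_bendNumber hdeg h
  exact (three_mul_two_pow_le (by omega)).trans (ha.two_pow_add_two_pow_le_card hT.isAcyclic hb)

theorem card_extremalVertex_even {m : ℕ} (hm : m ≠ 0) :
    Nat.card (ExtremalVertex (2 * m)) + 2 = 2 ^ (m + 2) := by
  obtain ⟨m, rfl⟩ := Nat.exists_eq_succ_of_ne_zero hm
  exact card_branchedPathVertex_even (m + 1)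

theorem card_extremalVertex_zero : Nat.card (ExtremalVertex 0) = 1 :=
  Nat.card_unique (α := Unit)

theorem card_extremalVertex_odd (m : ℕ) :
    Nat.card (ExtremalVertex (2 * m + 1)) + 2 = 3 * 2 ^ (m + 1) :=
  card_branchedPathVertex_odd m

theorem extremalTree_isTree (k : ℕ) : (extremalTree k).IsTree := by
  cases k with
  | zero => exact IsTree.of_subsingleton (V := Unit)
  | succ k => exact BranchedPath.isTree (k + 1)

theorem encard_neighborSet_extremalTree_le (k : ℕ) (v : ExtremalVertex k) :
    ((extremalTree k).neighborSet v).encard ≤ 4 := by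
  cases k with
  | zero =>
    have : (extremalTree 0).neighborSet v = ∅ := neighborSet_bot (V := Unit)
    rw [this]
    simp
  | succ k => exact BranchedPath.encard_neighborSet_le (k + 1) v

/-- The upper bound needs no explicit drawing: bend number at least `k + 1` would force more
vertices than `T_k` has. -/
theorem bendNumber_extremalTree (k : ℕ) : bendNumber (extremalTree k) = k := by
  have hT := extremalTree_isTree k
  have hdeg := encard_neighborSet_extremalTree_le k
  refine le_antisymm ?_ ?_
  · by_contra! hlt
    obtain ⟨m, rfl | rfl⟩ := Nat.even_or_odd' k
    · have h1 := hT.three_mul_two_pow_le_card_of_le_bendNumber hdeg hlt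
      have h2 : Nat.card (ExtremalVertex (2 * m)) + 2 ≤ 2 ^ (m + 2) := by
        rcases eq_or_ne m 0 with rfl | hm
        · rw [card_extremalVertex_zero]
          norm_num
        · exact (card_extremalVertex_even hm).le
      have h3 := Nat.two_pow_pos (m + 1)
      rw [pow_succ _ (m + 1)] at h2
      omega
    · have h1 := hT.two_pow_le_card_of_le_bendNumber hdeg (m := m + 1) (by omega) (by omega)
      rw [card_extremalVertex_odd, pow_add] at h1
      have h3 := Nat.two_pow_pos (m + 1)
      omega
  · cases k with
    | zero => exact Nat.zero_le _
    | succ k => exact BranchedPath.le_bendNumber (k + 1)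

theorem mainTheorem2 (k : ℕ) :
    -- every tree with bend number `k` has at least as many vertices as `T_k`
    (∀ (V : Type*) [Finite V] (T : SimpleGraph V),
      T.IsTree → (∀ v, (T.neighborSet v).encard ≤ 4) → bendNumber T = k →
        Nat.card (ExtremalVertex k) ≤ Nat.card V ∧
        (k ≠ 0 → Even k → 2 ^ ((k + 4) / 2) - 2 ≤ Nat.card V) ∧
        (Odd k → 3 * 2 ^ ((k + 1) / 2) - 2 ≤ Nat.card V)) ∧
    -- the number of vertices of `T_k`
    (k = 0 → Nat.card (ExtremalVertex k) = 1) ∧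
    (k ≠ 0 → Even k → Nat.card (ExtremalVertex k) = 2 ^ ((k + 4) / 2) - 2) ∧
    (Odd k → Nat.card (ExtremalVertex k) = 3 * 2 ^ ((k + 1) / 2) - 2) ∧
    -- `T_k` is itself a tree of maximum degree at most `4` with bend number `k`
    (extremalTree k).IsTree ∧
    (∀ v, ((extremalTree k).neighborSet v).encard ≤ 4) ∧
    Nonempty (StraightModel (extremalTree k)) ∧
    bendNumber (extremalTree k) = k := by
  have hzero : k = 0 → Nat.card (ExtremalVertex k) = 1 := by
    rintro rfl
    exact card_extremalVertex_zero
  have heven : k ≠ 0 → Even k → Nat.card (ExtremalVertex k) = 2 ^ ((k + 4) / 2) - 2 := by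
    rintro hk ⟨m, rfl⟩
    rw [← two_mul] at *
    rw [show (2 * m + 4) / 2 = m + 2 by omega, ← card_extremalVertex_even (m := m) (by omega),
      Nat.add_sub_cancel]
  have hodd : Odd k → Nat.card (ExtremalVertex k) = 3 * 2 ^ ((k + 1) / 2) - 2 := by
    rintro ⟨m, rfl⟩
    rw [show (2 * m + 1 + 1) / 2 = m + 1 by omega, ← card_extremalVertex_odd, Nat.add_sub_cancel]
  refine ⟨?_, hzero, heven, hodd, extremalTree_isTree k, encard_neighborSet_extremalTree_le k,
    (extremalTree_isTree k).nonempty_straightModel (encard_neighborSet_extremalTree_le k),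
    bendNumber_extremalTree k⟩
  intro V _ T hT hdeg hb
  have hcard : Nat.card (ExtremalVertex k) ≤ Nat.card V := by
    obtain ⟨m, rfl | rfl⟩ := Nat.even_or_odd' k
    · rcases eq_or_ne m 0 with rfl | hm
      · have := hT.connected.nonempty
        exact card_extremalVertex_zero.trans_le Nat.card_pos
      · have h1 := hT.two_pow_le_card_of_le_bendNumber hdeg hm hb.ge
        rw [← card_extremalVertex_even hm] at h1
        omega
    · have h1 := hT.three_mul_two_pow_le_card_of_le_bendNumber hdeg hb.ge
      rw [← card_extremalVertex_odd] at h1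
      omega
  exact ⟨hcard, fun h0 he => heven h0 he ▸ hcard, fun ho => hodd ho ▸ hcard⟩
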